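/- Let $F$ be a finitely generated free group. Call $u,v\in F$ trace equivalent if $\operatorname{tr}\alpha(u)=\operatorname{tr}\alpha(v)$ for every homomorphism $\alpha:F\to SL(2,\mathbb C)$. For an isometric action of $F$ on an $\mathbb R$-tree $X$ (a nonempty geodesic metric space that is $0$-hyperbolic) let $\ell_X(g)=\inf_{x\in X}d(x,gx)$. Call $g,h\in F$ translation equivalent, written $g\equiv_t h$, if $\ell_X(g)=\ell_X(h)$ for every free (no nontrivial element fixes a point) and discrete (every orbit is a discrete subset of $X$) isometric action of $F$ on an $\mathbb R$-tree $X$. Let $u,v\in F$ be trace equivalent, and let $w(x,y)$ be any element of the free group $F(x,y)$ on two letters. Then $\operatorname{tr}\alpha(w(u,v))=\operatorname{tr}\alpha(w(v,u))$ for every homomorphism $\alpha:F\to SL(2,\mathbb C)$, and $w(u,v)\equiv_t w(v,u)$ in $F$. -/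

import Mathlib

universe u v

/-- `g` and `h` are trace (character) equivalent in `F`: they have the same trace under every
representation of `F` in `SL(2, ℂ)`. -/
def TraceEquivalent {F : Type u} [Group F] (g h : F) : Prop :=
  ∀ α : F →* Matrix.SpecialLinearGroup (Fin 2) ℂ,
    Matrix.trace (α g : Matrix (Fin 2) (Fin 2) ℂ) = Matrix.trace (α h : Matrix (Fin 2) (Fin 2) ℂ)

/-- An `ℝ`-tree: a nonempty geodesic metric space which is `0`-hyperbolic, that is, satisfies the
four-point condition. -/
structure IsRTree (X : Type v) [MetricSpace X] : Prop where
  nonempty : Nonempty X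
  geodesic : ∀ x y : X, ∃ γ : ℝ → X, γ 0 = x ∧ γ (dist x y) = y ∧
    ∀ s ∈ Set.Icc 0 (dist x y), ∀ t ∈ Set.Icc 0 (dist x y), dist (γ s) (γ t) = |s - t|
  four_point : ∀ x y z w : X,
    dist x y + dist z w ≤ max (dist x z + dist y w) (dist x w + dist y z)

/-- The action of `F` on `X` is free: only the identity fixes a point. -/
def IsFreeAction (F : Type u) [Group F] (X : Type v) [MulAction F X] : Prop :=
  ∀ (g : F) (x : X), g • x = x → g = 1

/-- The action of `F` on the metric space `X` is discrete: every orbit is a discrete subset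
of `X`. -/
def IsDiscreteAction (F : Type u) [Group F] (X : Type v) [MetricSpace X] [MulAction F X] : Prop :=
  ∀ x : X, IsDiscrete (MulAction.orbit F x)

/-- The translation length of `g` on `X`: the infimum over `x : X` of `d(x, g x)`. -/
noncomputable def translationLength {F : Type u} [Group F] (X : Type v) [MetricSpace X]
    [MulAction F X] (g : F) : ℝ :=
  ⨅ x : X, dist x (g • x)

/-- `g` and `h` are translation equivalent in `F`: they have the same translation length for every
free and discrete isometric action of `F` on an `ℝ`-tree. -/
def TranslationEquivalent {F : Type u} [Group F] (g h : F) : Prop :=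
  ∀ (X : Type v) [MetricSpace X] [MulAction F X] [IsIsometricSMul F X],
    IsRTree X → IsFreeAction F X → IsDiscreteAction F X →
      translationLength X g = translationLength X h

/-- `w(g, h)`: the image of `w ∈ F(x, y)` under the homomorphism `x ↦ g`, `y ↦ h`. -/
def evalWord {F : Type u} [Group F] (w : FreeGroup (Fin 2)) (g h : F) : F :=
  FreeGroup.lift ![g, h] w

/-! Traces: if A, B in SL(2, ℂ) have the same trace t, and z = tr(AB), then Cayley–Hamilton gives A²
= tA - 1, B² = tB - 1 and AB + BA = tA + tB + z - t². These relations are symmetric in A and B, so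
w(A, B) and w(B, A) have the same coordinates with respect to 1, A, B, AB and 1, B, A, BA
(`swapRelated_evalWord`), hence equal traces.

Translation lengths: trace equivalence implies translation equivalence, because translation lengths
are growth rates of traces (`IsRTree.exists_tendsto_trace`). Medians of an orbit form the vertex set
of an invariant simplicial subtree. Give every ordered pair of vertices an invariant real label that
separates orbits of pairs, and put on an edge of length d the hyperbolic matrix with eigenvalues
exp(±τd) whose eigenlines are the labels of its two directions. This is an equivariant cocycle, and
its holonomy is a representation of F in SL(2, ℝ) for every τ. Rescaled, an edge matrix tends to a
rank one matrix as τ → ∞. Along a geodesic, successive rank one factors have nonzero product because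
different directions at a vertex carry different labels. On the axis of g this makes tr α_τ(g)
asymptotic to c exp(τℓ(g)) with c ≠ 0, so the traces determine ℓ(g). -/

/-! ### Trace identities in SL(2, ℂ) -/

/-- If `tr A = tr B`, any word `M` in `A, B` and the word `M'` obtained by exchanging `A` and `B`
have the same coordinates with respect to `1, A, B, AB` and `1, B, A, BA`. -/
def SwapRelated (A B M M' : Matrix (Fin 2) (Fin 2) ℂ) : Prop :=
  ∃ p q r s : ℂ, M = p • 1 + q • A + r • B + s • (A * B) ∧
    M' = p • 1 + q • B + r • A + s • (B * A)

namespace SwapRelated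

variable {A B M M' N N' : Matrix (Fin 2) (Fin 2) ℂ}

theorem one : SwapRelated A B 1 1 := ⟨1, 0, 0, 0, by simp, by simp⟩

theorem trace_eq (h : SwapRelated A B M M') (ht : A.trace = B.trace) : M.trace = M'.trace := by
  obtain ⟨p, q, r, s, rfl, rfl⟩ := h
  simp only [Matrix.trace_add, Matrix.trace_smul, ht, Matrix.trace_mul_comm A B]

/-- Handles inverse letters, since A⁻¹M = (tr A)M - AM when det A = 1. -/
theorem smul_sub (h : SwapRelated A B M M') (h' : SwapRelated A B N N') (c : ℂ) :
    SwapRelated A B (c • M - N) (c • M' - N') := by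
  obtain ⟨p, q, r, s, rfl, rfl⟩ := h
  obtain ⟨p', q', r', s', rfl, rfl⟩ := h'
  exact ⟨c * p - p', c * q - q', c * r - r', c * s - s', by module, by module⟩

theorem mul_left (hA : A.det = 1) (hB : B.det = 1) (ht : A.trace = B.trace)
    (h : SwapRelated A B M M') : SwapRelated A B (A * M) (B * M') := by
  obtain ⟨p, q, r, s, rfl, rfl⟩ := h
  rw [Matrix.det_fin_two] at hA hB
  rw [Matrix.trace_fin_two, Matrix.trace_fin_two] at ht
  refine ⟨-q, p + (A 0 0 + A 1 1) * q, -s, r + (A 0 0 + A 1 1) * s, ?_, ?_⟩ <;>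
  · ext i j
    fin_cases i <;> fin_cases j <;> simp [Matrix.mul_apply, Fin.sum_univ_two] <;> grind

theorem mul_right (hA : A.det = 1) (hB : B.det = 1) (ht : A.trace = B.trace)
    (h : SwapRelated A B M M') : SwapRelated A B (B * M) (A * M') := by
  obtain ⟨p, q, r, s, rfl, rfl⟩ := h
  have key : ∀ C D : Matrix (Fin 2) (Fin 2) ℂ, C.det = 1 → C.trace = D.trace →
      C * C = C.trace • C - 1 ∧
      D * C = (D * C).trace • 1 - (C.trace ^ 2) • 1 + C.trace • C + C.trace • D - C * D := by
    intro C D hC hCD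
    rw [Matrix.det_fin_two] at hC
    rw [Matrix.trace_fin_two, Matrix.trace_fin_two] at hCD
    constructor <;>
    · ext i j
      fin_cases i <;> fin_cases j <;>
        simp [Matrix.mul_apply, Fin.sum_univ_two, Matrix.trace_fin_two] <;> grind
  obtain ⟨hA2, hBA⟩ := key A B hA ht
  obtain ⟨hB2, hAB⟩ := key B A hB ht.symm
  have hz := Matrix.trace_mul_comm A B
  set t := A.trace
  set z := (B * A).trace
  rw [← ht] at hB2 hAB
  rw [hz] at hAB
  have e1 : B * (A * B) = z • B - t • 1 + A := by
    rw [← mul_assoc, hBA]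
    simp only [add_mul, sub_mul, smul_mul_assoc, one_mul, hB2, mul_assoc, mul_sub, mul_smul_comm,
      mul_one]
    module
  have e2 : A * (B * A) = z • A - t • 1 + B := by
    rw [← mul_assoc, hAB]
    simp only [add_mul, sub_mul, smul_mul_assoc, one_mul, hA2, mul_assoc, mul_sub, mul_smul_comm,
      mul_one]
    module
  -- Coordinates of B(p + qA + rB + sAB), from the formulas for BA, B² and BAB; the same formulas
  -- hold with A and B exchanged.
  refine ⟨q * (z - t ^ 2) - r - s * t, q * t + s, p + q * t + r * t + s * z, -q, ?_, ?_⟩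
  · simp only [mul_add, mul_smul_comm, mul_one, e1, hB2]
    rw [hBA]
    module
  · simp only [mul_add, mul_smul_comm, mul_one, e2, hA2]
    rw [hAB]
    module

end SwapRelated

theorem adjugate_fin_two_eq_trace_smul_sub (A : Matrix (Fin 2) (Fin 2) ℂ) :
    A.adjugate = A.trace • 1 - A := by
  ext i j
  fin_cases i <;> fin_cases j <;> simp [Matrix.adjugate_fin_two, Matrix.trace_fin_two]

theorem swapRelated_evalWord (A B : Matrix.SpecialLinearGroup (Fin 2) ℂ)
    (ht : (A : Matrix (Fin 2) (Fin 2) ℂ).trace = (B : Matrix (Fin 2) (Fin 2) ℂ).trace)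
    (w : FreeGroup (Fin 2)) :
    SwapRelated (A : Matrix (Fin 2) (Fin 2) ℂ) B (evalWord w A B : Matrix.SpecialLinearGroup _ _)
      (evalWord w B A : Matrix.SpecialLinearGroup _ _) := by
  have hw : w ∈ Subgroup.closure (Set.range (FreeGroup.of (α := Fin 2))) := by
    rw [FreeGroup.closure_range_of]; trivial
  have hL := fun M M' => SwapRelated.mul_left (M := M) (M' := M') A.det_coe B.det_coe ht
  have hR := fun M M' => SwapRelated.mul_right (M := M) (M' := M') A.det_coe B.det_coe ht
  induction hw using Subgroup.closure_induction_left with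
  | one => simpa [evalWord] using SwapRelated.one
  | mul_left x hx y hy ih =>
    obtain ⟨i, rfl⟩ := hx
    fin_cases i
    · simpa [evalWord] using hL _ _ ih
    · simpa [evalWord] using hR _ _ ih
  | inv_mul_cancel x hx y hy ih =>
    obtain ⟨i, rfl⟩ := hx
    fin_cases i
    · simpa [evalWord, adjugate_fin_two_eq_trace_smul_sub, sub_mul, ht, smul_mul_assoc] using
        ih.smul_sub (hL _ _ ih) (B : Matrix (Fin 2) (Fin 2) ℂ).trace
    · simpa [evalWord, adjugate_fin_two_eq_trace_smul_sub, sub_mul, ht, smul_mul_assoc] using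
        ih.smul_sub (hR _ _ ih) (B : Matrix (Fin 2) (Fin 2) ℂ).trace

theorem map_evalWord {F : Type u} {G : Type v} [Group F] [Group G] (α : F →* G)
    (w : FreeGroup (Fin 2)) (a b : F) : α (evalWord w a b) = evalWord w (α a) (α b) := by
  have : α.comp (FreeGroup.lift ![a, b]) = FreeGroup.lift ![α a, α b] := by
    ext i
    fin_cases i <;> simp
  exact DFunLike.congr_fun this w

theorem TraceEquivalent.evalWord {F : Type u} [Group F] {a b : F} (hab : TraceEquivalent a b)
    (w : FreeGroup (Fin 2)) : TraceEquivalent (evalWord w a b) (evalWord w b a) := by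
  intro α
  rw [map_evalWord, map_evalWord]
  exact (swapRelated_evalWord _ _ (hab α) w).trace_eq (hab α)

/-! ### Segments and medians in ℝ-trees -/

/-- The set of points between `x` and `y`. -/
def segm {X : Type v} [MetricSpace X] (x y : X) : Set X := {p | dist x p + dist p y = dist x y}

section Segments

variable {X : Type v} [MetricSpace X] {x y z w p q : X}

theorem mem_segm : p ∈ segm x y ↔ dist x p + dist p y = dist x y := Iff.rfl

theorem left_mem_segm (x y : X) : x ∈ segm x y := by simp [mem_segm]

theorem right_mem_segm (x y : X) : y ∈ segm x y := by simp [mem_segm]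

theorem segm_comm (x y : X) : segm x y = segm y x := by
  ext p
  rw [mem_segm, mem_segm, dist_comm x p, dist_comm p y, dist_comm x y, add_comm]

theorem segm_self (x : X) : segm x x = {x} := by
  ext p
  simp only [mem_segm, dist_self, Set.mem_singleton_iff]
  refine ⟨fun h => ?_, fun h => by simp [h]⟩
  rw [dist_comm x p] at h
  exact dist_le_zero.1 (by linarith [dist_nonneg (x := p) (y := x)])

theorem segm_subset_left (hp : p ∈ segm x y) : segm x p ⊆ segm x y := by
  intro q hq
  rw [mem_segm] at *
  linarith [dist_triangle q p y, dist_triangle x q y]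

theorem segm_subset_right (hp : p ∈ segm x y) : segm p y ⊆ segm x y := by
  rw [segm_comm] at hp ⊢
  rw [segm_comm x]
  exact segm_subset_left hp

theorem smul_mem_segm {F : Type u} [Group F] [MulAction F X] [IsIsometricSMul F X] (g : F) :
    g • p ∈ segm (g • x) (g • y) ↔ p ∈ segm x y := by
  simp [mem_segm]

namespace IsRTree

variable (hX : IsRTree X)
include hX

/-- The four-point condition for p, q, x, y bounds d(p, q) above. Hence a point of a segment is
determined by its distance to one end. -/
theorem dist_of_mem_segm (hp : p ∈ segm x y) (hq : q ∈ segm x y) :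
    dist p q = |dist x p - dist x q| := by
  rw [mem_segm] at *
  have h := hX.four_point p q x y
  have h1 := dist_triangle x p q
  have h2 := dist_triangle x q p
  rw [dist_comm p x, dist_comm q x, dist_comm q p] at *
  apply le_antisymm
  · rcases le_max_iff.1 h with h | h
    · exact le_trans (by linarith) (le_abs_self _)
    · exact le_trans (by linarith) (neg_le_abs _)
  · exact abs_le.2 ⟨by linarith, by linarith⟩

theorem eq_of_mem_segm (hp : p ∈ segm x y) (hq : q ∈ segm x y) (h : dist x p = dist x q) :
    p = q := by
  rw [← dist_eq_zero, hX.dist_of_mem_segm hp hq, h]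
  simp

theorem mem_segm_of_dist_le (hp : p ∈ segm x y) (hq : q ∈ segm x y) (h : dist x p ≤ dist x q) :
    p ∈ segm x q := by
  rw [mem_segm, hX.dist_of_mem_segm hp hq, abs_of_nonpos (by linarith)]
  ring

theorem exists_mem_segm (x y : X) {t : ℝ} (h0 : 0 ≤ t) (h1 : t ≤ dist x y) :
    ∃ p ∈ segm x y, dist x p = t := by
  obtain ⟨γ, hγ0, hγ1, h⟩ := hX.geodesic x y
  have e1 := h 0 ⟨le_rfl, dist_nonneg⟩ t ⟨h0, h1⟩
  have e2 := h t ⟨h0, h1⟩ _ ⟨dist_nonneg, le_rfl⟩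
  rw [hγ0, zero_sub, abs_neg, abs_of_nonneg h0] at e1
  rw [hγ1, abs_of_nonpos (by linarith)] at e2
  exact ⟨γ t, by rw [mem_segm, e1, e2]; ring, e1⟩

theorem isCompact_segm (x y : X) : IsCompact (segm x y) := by
  obtain ⟨γ, hγ0, hγ1, h⟩ := hX.geodesic x y
  have : segm x y = γ '' Set.Icc 0 (dist x y) := by
    ext p
    constructor
    · intro hp
      have hp' := mem_segm.1 hp
      have hd : dist x p ∈ Set.Icc 0 (dist x y) :=
        ⟨dist_nonneg, by linarith [dist_nonneg (x := p) (y := y)]⟩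
      have e1 := h 0 ⟨le_rfl, dist_nonneg⟩ _ hd
      have e2 := h _ hd _ ⟨dist_nonneg, le_rfl⟩
      rw [hγ0, zero_sub, abs_neg, abs_of_nonneg hd.1] at e1
      rw [hγ1, abs_of_nonpos (by linarith [hd.2])] at e2
      exact ⟨_, hd, hX.eq_of_mem_segm (by rw [mem_segm, e1, e2]; ring) hp e1⟩
    · rintro ⟨t, ht, rfl⟩
      have e1 := h 0 ⟨le_rfl, dist_nonneg⟩ t ht
      have e2 := h t ht _ ⟨dist_nonneg, le_rfl⟩
      rw [hγ0, zero_sub, abs_neg, abs_of_nonneg ht.1] at e1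
      rw [hγ1, abs_of_nonpos (by linarith [ht.2])] at e2
      rw [mem_segm, e1, e2]; ring
  rw [this]
  refine isCompact_Icc.image_of_continuousOn (LipschitzOnWith.continuousOn (K := 1) ?_)
  refine LipschitzOnWith.of_dist_le_mul fun s hs t ht => ?_
  rw [h s hs t ht, Real.dist_eq]
  simp

/-- Triangles are tripods: each side lies in the union of the other two. -/
theorem mem_segm_or (hp : p ∈ segm x y) (z : X) : p ∈ segm x z ∨ p ∈ segm z y := by
  rw [mem_segm, mem_segm]
  rw [mem_segm] at hp
  have h := hX.four_point p z x y
  rw [dist_comm p x] at h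
  have h1 := dist_triangle x p z
  have h2 := dist_triangle z p y
  rw [dist_comm z p] at *
  rw [dist_comm z x] at *
  rcases le_max_iff.1 h with h | h
  · right; linarith
  · left; linarith

/-- Two geodesics that overlap in a nondegenerate segment concatenate to a geodesic. -/
theorem mem_segm_trans (hy : y ∈ segm x p) (hp : p ∈ segm y z) (hne : y ≠ p) : p ∈ segm x z := by
  rw [mem_segm] at *
  have h := hX.four_point x p y z
  have h1 := dist_triangle x p z
  have h2 := dist_pos.2 hne
  rw [dist_comm p y] at h
  rcases le_max_iff.1 h with h | h <;> linarith

theorem exists_median (x y z : X) :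
    ∃ p ∈ segm x y, p ∈ segm x z ∧ p ∈ segm y z ∧
      dist x p = (dist x y + dist x z - dist y z) / 2 := by
  obtain ⟨p, hp, hd⟩ := hX.exists_mem_segm x y (t := (dist x y + dist x z - dist y z) / 2)
    (by linarith [dist_triangle y x z, dist_comm x y])
    (by linarith [dist_triangle x y z])
  rw [mem_segm] at hp
  have h := hX.four_point p z x y
  have h1 := dist_triangle x p z
  have h2 := dist_triangle y p z
  rw [dist_comm p x, dist_comm z x, dist_comm z y] at h
  rw [dist_comm p y] at *
  have hpz : dist p z = dist x z - dist x p := by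
    apply le_antisymm
    · rcases le_max_iff.1 h with h | h <;> linarith
    · linarith
  refine ⟨p, ?_, ?_, ?_, hd⟩ <;> rw [mem_segm] <;> try rw [dist_comm p y]
  all_goals linarith

omit hX in
theorem dist_median (h1 : p ∈ segm x y) (h2 : p ∈ segm x z) (h3 : p ∈ segm y z) :
    dist x p = (dist x y + dist x z - dist y z) / 2 := by
  rw [mem_segm] at *
  rw [dist_comm y p] at *
  linarith

end IsRTree

end Segments

/-! ### The simplicial subtree spanned by an orbit -/

/-- An invariant countable set of points of `X`, closed under medians and meeting each segment
between two of its points in a finite set: the vertex set of a simplicial subtree. -/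
structure IsVertexSet (F : Type u) [Group F] {X : Type v} [MetricSpace X] [MulAction F X]
    (V : Set X) : Prop where
  smul_mem : ∀ (g : F) {y : X}, y ∈ V → g • y ∈ V
  median_mem : ∀ {x y z p : X}, x ∈ V → y ∈ V → z ∈ V → p ∈ segm x y → p ∈ segm x z →
    p ∈ segm y z → p ∈ V
  finite : ∀ {y z : X}, y ∈ V → z ∈ V → (V ∩ segm y z).Finite
  countable : V.Countable

/-- The medians of triples of points of the orbit of `x`. -/
def orbitMedians (F : Type u) [Group F] {X : Type v} [MetricSpace X] [MulAction F X] (x : X) :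
    Set X :=
  {p | ∃ g h k : F, p ∈ segm (g • x) (h • x) ∧ p ∈ segm (g • x) (k • x) ∧
    p ∈ segm (h • x) (k • x)}

section

variable {F : Type u} [Group F] {X : Type v} [MetricSpace X] [MulAction F X]

theorem smul_mem_orbitMedians_self (g : F) (x : X) : g • x ∈ orbitMedians F x :=
  ⟨g, g, g, left_mem_segm _ _, left_mem_segm _ _, left_mem_segm _ _⟩

variable [IsIsometricSMul F X]

theorem smul_mem_orbitMedians {x p : X} (f : F) (hp : p ∈ orbitMedians F x) :
    f • p ∈ orbitMedians F x := by
  obtain ⟨g, h, k, h1, h2, h3⟩ := hp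
  refine ⟨f * g, f * h, f * k, ?_, ?_, ?_⟩ <;> simpa only [mul_smul, smul_mem_segm]

theorem exists_pos_le_dist_of_ne (hf : IsFreeAction F X) (hd : IsDiscreteAction F X) (x : X) :
    ∃ r > 0, ∀ f g : F, dist (f • x) (g • x) < r → f = g := by
  obtain ⟨r, hr, h⟩ := Metric.exists_ball_inter_eq_singleton_of_mem_discrete (hd x)
    (MulAction.mem_orbit_self (M := F) x)
  refine ⟨r, hr, fun f g hfg => ?_⟩
  have h1 : (g⁻¹ * f) • x ∈ Metric.ball x r ∩ MulAction.orbit F x := by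
    refine ⟨?_, MulAction.mem_orbit _ _⟩
    rw [Metric.mem_ball, ← dist_smul g]
    simpa [mul_smul] using hfg
  rw [h] at h1
  exact (inv_mul_eq_one.1 (hf _ _ h1)).symm

/-- For infinitely many such f, pass to a limit k → a, f k → b. Then f a → b, so two distinct f move
a to points closer than the separation of its orbit. -/
theorem finite_setOf_smul_inter_nonempty (hf : IsFreeAction F X) (hd : IsDiscreteAction F X)
    {K L : Set X} (hK : IsCompact K) (hL : IsCompact L) :
    {f : F | ∃ k ∈ K, f • k ∈ L}.Finite := by
  by_contra hinf
  let φ := Set.Infinite.natEmbedding _ hinf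
  choose k hk hkL using fun n => (φ n).2
  obtain ⟨a, -, n, hn, ha⟩ := (hK.prod hL).tendsto_subseq
    (x := fun i => (k i, (φ i : F) • k i)) fun i => ⟨hk i, hkL i⟩
  have h1 := (continuous_fst.tendsto _).comp ha
  have h2 := (continuous_snd.tendsto _).comp ha
  obtain ⟨r, hr, H⟩ := exists_pos_le_dist_of_ne hf hd a.1
  have h3 : Filter.Tendsto (fun i => dist (k (n i)) a.1 + dist ((φ (n i) : F) • k (n i)) a.2)
      Filter.atTop (nhds 0) := by
    simpa using (tendsto_iff_dist_tendsto_zero.1 h1).add (tendsto_iff_dist_tendsto_zero.1 h2)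
  obtain ⟨N, hN⟩ := Filter.eventually_atTop.1 (h3.eventually (gt_mem_nhds (half_pos hr)))
  have h4 : ∀ i ≥ N, dist ((φ (n i) : F) • a.1) a.2 < r / 2 := by
    intro i hi
    refine lt_of_le_of_lt (dist_triangle _ ((φ (n i) : F) • k (n i)) _) ?_
    rw [dist_smul, dist_comm]
    exact hN i hi
  have h5 := H (φ (n N)) (φ (n (N + 1))) <| by
    have := dist_triangle_right ((φ (n N) : F) • a.1) ((φ (n (N + 1)) : F) • a.1) a.2
    linarith [h4 N le_rfl, h4 (N + 1) (Nat.le_succ N)]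
  have h6 := hn.injective (φ.injective (Subtype.ext h5))
  omega

end

namespace IsRTree

variable {F : Type u} [Group F] {X : Type v} [MetricSpace X] [MulAction F X]
variable (hX : IsRTree X)
include hX

/-- If the projections of `p` and `q` to the segment `[x, y]` differ, then `[p, q]` meets
`[x, y]`. -/
theorem exists_mem_segm_inter {x y p q : X}
    (h : dist x p - dist y p ≠ dist x q - dist y q) : ∃ m ∈ segm p q, m ∈ segm x y := by
  obtain ⟨a, ha1, ha2, ha3, -⟩ := hX.exists_median x y p
  obtain ⟨b, hb1, hb2, hb3, -⟩ := hX.exists_median x y q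
  rcases hX.mem_segm_or ha2 q with h1 | h1
  · rcases hX.mem_segm_or ha3 q with h2 | h2
    · have e1 := IsRTree.dist_median ha1 ha2 ha3
      have e2 := IsRTree.dist_median ha1 h1 h2
      exact absurd (by linarith) h
    · exact ⟨a, by rwa [segm_comm], ha1⟩
  · exact ⟨a, by rwa [segm_comm], ha1⟩

/-- The point p separates y from at least two of the three orbit points, and likewise z, so some
orbit point serves both. -/
theorem exists_median_of_mem_orbitMedians {x p : X} (y z : X)
    (hp : p ∈ orbitMedians F x) :
    ∃ k : F, p ∈ segm y (k • x) ∧ p ∈ segm z (k • x) := by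
  obtain ⟨g, h, k, h1, h2, h3⟩ := hp
  have a1 := hX.mem_segm_or h1 y
  have a2 := hX.mem_segm_or h2 y
  have a3 := hX.mem_segm_or h3 y
  have b1 := hX.mem_segm_or h1 z
  have b2 := hX.mem_segm_or h2 z
  have b3 := hX.mem_segm_or h3 z
  rw [segm_comm _ y] at a1 a2 a3
  rw [segm_comm _ z] at b1 b2 b3
  by_cases c1 : p ∈ segm y (g • x) ∧ p ∈ segm z (g • x)
  · exact ⟨g, c1⟩
  by_cases c2 : p ∈ segm y (h • x) ∧ p ∈ segm z (h • x)
  · exact ⟨h, c2⟩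
  exact ⟨k, by tauto⟩

/-- A median of `y`, `z`, `w` different from the vertex `y` remains a median when `y` is replaced
by a suitable point of the orbit. -/
theorem exists_smul_mem_segm {x p y z w : X} (hy : y ∈ orbitMedians F x) (hne : y ≠ p)
    (hz : p ∈ segm y z) (hw : p ∈ segm y w) :
    ∃ g : F, p ∈ segm (g • x) z ∧ p ∈ segm (g • x) w := by
  obtain ⟨g, h, -, h1, -, -⟩ := hy
  rcases hX.mem_segm_or h1 p with h2 | h2
  · exact ⟨g, hX.mem_segm_trans h2 hz hne, hX.mem_segm_trans h2 hw hne⟩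
  · rw [segm_comm] at h2
    exact ⟨h, hX.mem_segm_trans h2 hz hne, hX.mem_segm_trans h2 hw hne⟩

variable [IsIsometricSMul F X]

/-- For a generator s, the values at f and fs can differ only if f[x, sx] meets [x, y], which
happens for finitely many f. Walking along words in finitely many generators therefore produces
finitely many values. -/
theorem finite_range_dist_sub_dist [Group.FG F] (hf : IsFreeAction F X)
    (hd : IsDiscreteAction F X) (x y : X) :
    (Set.range fun k : F => dist x (k • x) - dist y (k • x)).Finite := by
  obtain ⟨S, hS, hSfin⟩ := Group.fg_iff.1 ‹Group.FG F›
  set c : F → ℝ := fun k => dist x (k • x) - dist y (k • x) with hc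
  set P : F → Set F := fun s => {f | ∃ k ∈ segm x (s • x), f • k ∈ segm x y}
  have hP : ∀ s, (P s).Finite := fun s =>
    finite_setOf_smul_inter_nonempty hf hd (hX.isCompact_segm _ _) (hX.isCompact_segm _ _)
  have step : ∀ s f : F, c (f * s) = c f ∨ f ∈ P s := by
    intro s f
    rw [or_iff_not_imp_left]
    intro hne
    obtain ⟨m, hm1, hm2⟩ := hX.exists_mem_segm_inter (x := x) (y := y) (p := f • x)
      (q := (f * s) • x) (Ne.symm hne)
    refine ⟨f⁻¹ • m, ?_, by simpa using hm2⟩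
    rw [← smul_mem_segm f]
    simpa [mul_smul] using hm1
  set S' := S ∪ S⁻¹
  have hfin : (insert (c 1) (⋃ s ∈ S', (fun f => c (f * s)) '' P s)).Finite :=
    ((hSfin.union hSfin.inv).biUnion fun s _ => (hP s).image _).insert _
  refine hfin.subset ?_
  rintro _ ⟨k, rfl⟩
  have hk : k ∈ Subgroup.closure S := by rw [hS]; trivial
  have aux : ∀ f, ∀ s ∈ S', c f ∈ insert (c 1) (⋃ s ∈ S', (fun f => c (f * s)) '' P s) →
      c (f * s) ∈ insert (c 1) (⋃ s ∈ S', (fun f => c (f * s)) '' P s) := by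
    intro f s hs hfs
    rcases step s f with h | h
    · rwa [h]
    · exact Or.inr (Set.mem_biUnion hs ⟨f, h, rfl⟩)
  change c k ∈ _
  induction hk using Subgroup.closure_induction_right with
  | one => exact Set.mem_insert _ _
  | mul_right f _ s hs ih => exact aux f s (Or.inl hs) ih
  | mul_inv_cancel f _ s hs ih => exact aux f s⁻¹ (Or.inr (by simpa using hs)) ih

theorem finite_orbitMedians_inter_segm [Group.FG F] (hf : IsFreeAction F X)
    (hd : IsDiscreteAction F X) (x y z : X) : (orbitMedians F x ∩ segm y z).Finite := by
  have key : ∀ y, (orbitMedians F x ∩ segm x y).Finite := by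
    intro y
    -- A vertex p of [x, y] is the median of x, y and some kx, so d(x, p) is a Gromov product with
    -- finitely many possible values.
    refine Set.Finite.of_finite_image (f := dist x)
      (((hX.finite_range_dist_sub_dist (F := F) hf hd x y).image
        fun t => (dist x y + t) / 2).subset ?_) ?_
    · rintro _ ⟨p, ⟨hp, hpy⟩, rfl⟩
      obtain ⟨k, h1, h2⟩ := hX.exists_median_of_mem_orbitMedians x y hp
      refine ⟨_, ⟨k, rfl⟩, ?_⟩
      have := IsRTree.dist_median hpy h1 h2
      simp only
      linarith
    · intro p hp q hq h
      exact hX.eq_of_mem_segm hp.2 hq.2 h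
  refine ((key y).union (key z)).subset ?_
  rintro p ⟨hp, hpyz⟩
  rcases hX.mem_segm_or hpyz x with h | h
  · exact Or.inl ⟨hp, by rwa [segm_comm]⟩
  · exact Or.inr ⟨hp, h⟩

theorem isVertexSet_orbitMedians [Group.FG F] (hf : IsFreeAction F X)
    (hd : IsDiscreteAction F X) (x : X) : IsVertexSet F (orbitMedians F x) where
  smul_mem g _ hy := smul_mem_orbitMedians g hy
  finite _ _ := hX.finite_orbitMedians_inter_segm hf hd x _ _
  median_mem {y z w p} hy hz hw h1 h2 h3 := by
    by_cases hyp : y = p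
    · rwa [← hyp]
    by_cases hzp : z = p
    · rwa [← hzp]
    by_cases hwp : w = p
    · rwa [← hwp]
    -- Replace the three vertices by orbit points one at a time, keeping p as the median.
    obtain ⟨g, g1, g2⟩ := hX.exists_smul_mem_segm hy hyp h1 h2
    rw [segm_comm] at g1
    obtain ⟨h, k1, k2⟩ := hX.exists_smul_mem_segm hz hzp g1 h3
    rw [segm_comm] at g2 k2
    obtain ⟨k, l1, l2⟩ := hX.exists_smul_mem_segm hw hwp g2 k2
    rw [segm_comm] at k1 l1 l2
    exact ⟨g, h, k, k1, l1, l2⟩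
  countable := by
    have : Countable F := by
      obtain ⟨S, hS, φ, hφ⟩ := Monoid.fg_iff_exists_freeMonoid_hom_surjective.1
        (Group.fg_iff_monoid_fg.1 ‹Group.FG F›)
      have := hS.to_countable
      have : Countable (FreeMonoid S) := inferInstanceAs (Countable (List S))
      exact hφ.countable
    have hsub : orbitMedians F x ⊆ ⋃ t : F × F × F, {p | p ∈ segm (t.1 • x) (t.2.1 • x) ∧
        p ∈ segm (t.1 • x) (t.2.2 • x) ∧ p ∈ segm (t.2.1 • x) (t.2.2 • x)} := by
      rintro p ⟨g, h, k, hp⟩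
      exact Set.mem_iUnion.2 ⟨(g, h, k), hp⟩
    refine Set.Countable.mono hsub (Set.countable_iUnion fun t => Set.Subsingleton.countable ?_)
    rintro p ⟨p1, p2, p3⟩ q ⟨q1, q2, q3⟩
    exact hX.eq_of_mem_segm p1 q1
      ((IsRTree.dist_median p1 p2 p3).trans (IsRTree.dist_median q1 q2 q3).symm)

end IsRTree

/-! ### Adjacent vertices, cocycles and labels -/

open Classical in
/-- The vertex adjacent to `y` on the segment `[y, z]`. -/
noncomputable def firstVertex {X : Type v} [MetricSpace X] (V : Set X) (y z : X) : X :=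
  if h : ∃ p ∈ (V ∩ segm y z) \ {y}, ∀ q ∈ (V ∩ segm y z) \ {y}, dist y p ≤ dist y q
  then h.choose else y

/-- `lab` is an invariant labelling of pairs of points that separates the orbits of pairs of
vertices. -/
structure IsLabel (F : Type u) [Group F] {X : Type v} [MulAction F X] (V : Set X)
    (lab : X → X → ℝ) : Prop where
  smul : ∀ (g : F) (y z : X), lab (g • y) (g • z) = lab y z
  exists_smul : ∀ {y z y' z' : X}, y ∈ V → z ∈ V → y' ∈ V → z' ∈ V → lab y z = lab y' z' →
    ∃ g : F, g • y = y' ∧ g • z = z'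

namespace IsVertexSet

variable {F : Type u} [Group F] {X : Type v} [MetricSpace X] [MulAction F X]
variable {V : Set X} (hV : IsVertexSet F V) {y z p : X}
include hV

theorem firstVertex_spec (hy : y ∈ V) (hz : z ∈ V) (hne : y ≠ z) :
    firstVertex V y z ∈ (V ∩ segm y z) \ {y} ∧
      ∀ q ∈ (V ∩ segm y z) \ {y}, dist y (firstVertex V y z) ≤ dist y q := by
  have h := Set.exists_min_image _ (dist y) ((hV.finite hy hz).sdiff (t := {y}))
    ⟨z, ⟨hz, right_mem_segm y z⟩, hne.symm⟩
  rw [firstVertex, dif_pos h]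
  exact h.choose_spec

theorem firstVertex_mem (hy : y ∈ V) (hz : z ∈ V) (hne : y ≠ z) : firstVertex V y z ∈ V :=
  (hV.firstVertex_spec hy hz hne).1.1.1

theorem firstVertex_mem_segm (hy : y ∈ V) (hz : z ∈ V) (hne : y ≠ z) :
    firstVertex V y z ∈ segm y z :=
  (hV.firstVertex_spec hy hz hne).1.1.2

theorem firstVertex_ne (hy : y ∈ V) (hz : z ∈ V) (hne : y ≠ z) : firstVertex V y z ≠ y :=
  (hV.firstVertex_spec hy hz hne).1.2

theorem dist_firstVertex_le (hy : y ∈ V) (hz : z ∈ V) (hne : y ≠ z) (hp : p ∈ V)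
    (hpyz : p ∈ segm y z) (hpy : p ≠ y) : dist y (firstVertex V y z) ≤ dist y p :=
  (hV.firstVertex_spec hy hz hne).2 p ⟨⟨hp, hpyz⟩, hpy⟩

theorem ncard_firstVertex_lt (hy : y ∈ V) (hz : z ∈ V) (hne : y ≠ z) :
    (V ∩ segm (firstVertex V y z) z).ncard < (V ∩ segm y z).ncard := by
  have hf := hV.firstVertex_mem_segm hy hz hne
  refine Set.ncard_lt_ncard ?_ (hV.finite hy hz)
  refine (Set.ssubset_iff_of_subset
    (Set.inter_subset_inter_right _ (segm_subset_right hf))).2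
    ⟨y, ⟨hy, left_mem_segm y z⟩, fun h => ?_⟩
  have h1 := mem_segm.1 h.2
  have h2 := mem_segm.1 hf
  rw [dist_comm _ y] at h1
  exact hV.firstVertex_ne hy hz hne (dist_le_zero.1 (by linarith [dist_comm y (firstVertex V y z)]))

/-- Induction along the vertices of segments. -/
theorem segm_induction {P : X → X → Prop} (refl : ∀ y ∈ V, P y y)
    (step : ∀ y ∈ V, ∀ z ∈ V, y ≠ z → P (firstVertex V y z) z → P y z)
    (hy : y ∈ V) (hz : z ∈ V) : P y z := by
  induction hn : (V ∩ segm y z).ncard using Nat.strong_induction_on generalizing y with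
  | _ n ih =>
    by_cases hne : y = z
    · exact hne ▸ refl y hy
    · exact step y hy z hz hne (ih _ (hn ▸ hV.ncard_firstVertex_lt hy hz hne)
        (hV.firstVertex_mem hy hz hne) rfl)

variable (hX : IsRTree X)
include hX

theorem firstVertex_eq_of_mem_segm (hy : y ∈ V) (hz : z ∈ V) (hp : p ∈ V)
    (hpyz : p ∈ segm y z) (hpy : p ≠ y) : firstVertex V y p = firstVertex V y z := by
  have hne : y ≠ z := by
    rintro rfl
    rw [segm_self] at hpyz
    exact hpy hpyz
  have h1 := hV.firstVertex_mem_segm hy hp hpy.symm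
  have h2 := hV.firstVertex_mem_segm hy hz hne
  have h3 := hX.mem_segm_of_dist_le h2 hpyz (hV.dist_firstVertex_le hy hz hne hp hpyz hpy)
  refine hX.eq_of_mem_segm h1 h3 (le_antisymm ?_ ?_)
  · exact hV.dist_firstVertex_le hy hp hpy.symm (hV.firstVertex_mem hy hz hne) h3
      (hV.firstVertex_ne hy hz hne)
  · exact hV.dist_firstVertex_le hy hz hne (hV.firstVertex_mem hy hp hpy.symm)
      (segm_subset_left hpyz h1) (hV.firstVertex_ne hy hp hpy.symm)

theorem firstVertex_self (hy : y ∈ V) (hz : z ∈ V) (hne : y ≠ z) :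
    firstVertex V y (firstVertex V y z) = firstVertex V y z :=
  hV.firstVertex_eq_of_mem_segm hX hy hz (hV.firstVertex_mem hy hz hne)
    (hV.firstVertex_mem_segm hy hz hne) (hV.firstVertex_ne hy hz hne)

omit hX in
/-- There is no vertex strictly between `y` and the next vertex. -/
theorem eq_or_eq_of_mem_segm_firstVertex (hy : y ∈ V) (hz : z ∈ V) (hne : y ≠ z) (hp : p ∈ V)
    (hpf : p ∈ segm y (firstVertex V y z)) : p = y ∨ p = firstVertex V y z := by
  rw [or_iff_not_imp_left]
  intro hpy
  have hf := hV.firstVertex_mem_segm hy hz hne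
  have h1 := hV.dist_firstVertex_le hy hz hne hp (segm_subset_left hf hpf) hpy
  exact dist_le_zero.1 (by linarith [mem_segm.1 hpf])

omit hX in
theorem firstVertex_symm (hy : y ∈ V) (hz : z ∈ V) (hne : y ≠ z) :
    firstVertex V (firstVertex V y z) y = y := by
  have hf := hV.firstVertex_mem hy hz hne
  have hfy := hV.firstVertex_ne hy hz hne
  have h1 := hV.firstVertex_mem_segm hf hy hfy
  rw [segm_comm] at h1
  exact (hV.eq_or_eq_of_mem_segm_firstVertex hy hz hne (hV.firstVertex_mem hf hy hfy)
    h1).resolve_right (hV.firstVertex_ne hf hy hfy)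

theorem smul_firstVertex [IsIsometricSMul F X] (hy : y ∈ V) (hz : z ∈ V) (hne : y ≠ z) (g : F) :
    firstVertex V (g • y) (g • z) = g • firstVertex V y z := by
  have hy' := hV.smul_mem g hy
  have hz' := hV.smul_mem g hz
  have hne' : g • y ≠ g • z := by simpa using hne
  have h1 := hV.firstVertex_mem_segm hy' hz' hne'
  have h2 := (smul_mem_segm g).2 (hV.firstVertex_mem_segm hy hz hne)
  refine hX.eq_of_mem_segm h1 h2 (le_antisymm ?_ ?_)
  · exact hV.dist_firstVertex_le hy' hz' hne' (hV.smul_mem g (hV.firstVertex_mem hy hz hne)) h2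
      (by simpa using hV.firstVertex_ne hy hz hne)
  · set f := firstVertex V (g • y) (g • z) with hf
    have h3 : g⁻¹ • f ∈ segm y z := by rw [← smul_mem_segm g]; simpa using h1
    have h4 : g⁻¹ • f ≠ y := by
      rw [Ne, inv_smul_eq_iff]
      exact hV.firstVertex_ne hy' hz' hne'
    have := hV.dist_firstVertex_le hy hz hne
      (hV.smul_mem g⁻¹ (hV.firstVertex_mem hy' hz' hne')) h3 h4
    rw [dist_smul]
    rwa [← dist_smul g y (g⁻¹ • f), smul_inv_smul] at this

variable {G : Type*} [Group G]

omit hX in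
/-- A potential for the `G`-valued function `M` on pairs of adjacent vertices. -/
theorem exists_potential (M : X → X → G) {o : X} (ho : o ∈ V) :
    ∃ φ : X → G, ∀ y ∈ V, y ≠ o → φ y = φ (firstVertex V y o) * M (firstVertex V y o) y := by
  classical
  -- Recursion towards the root o with n as fuel; any n at least the number of vertices on [y, o]
  -- gives the same value.
  let ψ : ℕ → X → G := fun n => Nat.rec (fun _ => 1)
    (fun _ ψ y => if y = o then 1 else ψ (firstVertex V y o) * M (firstVertex V y o) y) n
  have hψ : ∀ n y, ψ (n + 1) y =
      if y = o then 1 else ψ n (firstVertex V y o) * M (firstVertex V y o) y := fun _ _ => rfl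
  have key : ∀ n m, ∀ y ∈ V, (V ∩ segm y o).ncard ≤ n → (V ∩ segm y o).ncard ≤ m →
      ψ n y = ψ m y := by
    intro n
    induction n with
    | zero =>
      intro m y hy hn
      have : (V ∩ segm y o).ncard ≠ 0 :=
        Set.ncard_ne_zero_of_mem ⟨hy, left_mem_segm y o⟩ (hV.finite hy ho)
      omega
    | succ n ih =>
      intro m y hy hn hm
      have : (V ∩ segm y o).ncard ≠ 0 :=
        Set.ncard_ne_zero_of_mem ⟨hy, left_mem_segm y o⟩ (hV.finite hy ho)
      obtain ⟨m, rfl⟩ : ∃ k, m = k + 1 := ⟨m - 1, by omega⟩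
      rw [hψ, hψ]
      split_ifs with h
      · rfl
      · have h1 := hV.ncard_firstVertex_lt hy ho h
        rw [ih m _ (hV.firstVertex_mem hy ho h) (by omega) (by omega)]
  refine ⟨fun y => ψ (V ∩ segm y o).ncard y, fun y hy hyo => ?_⟩
  have h1 := hV.ncard_firstVertex_lt hy ho hyo
  simp only
  rw [key _ ((V ∩ segm y o).ncard + 1) y hy le_rfl (by omega), hψ, if_neg hyo,
    key _ (V ∩ segm y o).ncard _ (hV.firstVertex_mem hy ho hyo) le_rfl h1.le]

/-- An equivariant function on pairs of adjacent vertices, compatible with inversion, extends to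
an equivariant cocycle. -/
theorem exists_cocycle [IsIsometricSMul F X] (M : X → X → G) (hinv : ∀ y z, M z y = (M y z)⁻¹)
    (hM : ∀ (g : F) (y z : X), M (g • y) (g • z) = M y z) :
    ∃ H : X → X → G, (∀ y z w, H y z * H z w = H y w) ∧
      (∀ y ∈ V, ∀ z ∈ V, y ≠ z → H y (firstVertex V y z) = M y (firstVertex V y z)) ∧
      ∀ (g : F), ∀ y ∈ V, ∀ z ∈ V, H (g • y) (g • z) = H y z := by
  rcases V.eq_empty_or_nonempty with rfl | ⟨o, ho⟩
  · exact ⟨fun _ _ => 1, by simp⟩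
  obtain ⟨φ, hφ⟩ := hV.exists_potential M ho
  have hmul : ∀ y z w, (φ y)⁻¹ * φ z * ((φ z)⁻¹ * φ w) = (φ y)⁻¹ * φ w := by
    intros; group
  have hadj : ∀ y ∈ V, ∀ z ∈ V, y ≠ z →
      (φ y)⁻¹ * φ (firstVertex V y z) = M y (firstVertex V y z) := by
    intro y hy z hz hne
    have hf := hV.firstVertex_mem hy hz hne
    have hfy := hV.firstVertex_ne hy hz hne
    have hff := hV.firstVertex_self hX hy hz hne
    have hsymm := hV.firstVertex_symm hy hz hne
    have hbtw := fun p => hV.eq_or_eq_of_mem_segm_firstVertex (p := p) hy hz hne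
    generalize firstVertex V y z = f at *
    -- The median is a vertex of the edge [y, f], hence y or f: the edge points away from the root
    -- or towards it.
    obtain ⟨p, h1, h2, h3, -⟩ := hX.exists_median y f o
    rcases hbtw p (hV.median_mem hy hf ho h1 h2 h3) h1 with rfl | rfl
    · have hfo : f ≠ o := by
        rintro rfl
        rw [segm_self] at h3
        exact hfy h3.symm
      rw [hφ f hf hfo, ← hV.firstVertex_eq_of_mem_segm hX hf ho hy h3 hfy.symm, hsymm]
      group
    · have hyo : y ≠ o := by
        rintro rfl
        rw [segm_self] at h2
        exact hfy h2
      rw [hφ y hy hyo, ← hV.firstVertex_eq_of_mem_segm hX hy ho hf h2 hfy, hff, hinv]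
      group
  refine ⟨fun y z => (φ y)⁻¹ * φ z, hmul, hadj, fun g y hy z hz => ?_⟩
  refine hV.segm_induction (P := fun y z => (φ (g • y))⁻¹ * φ (g • z) = (φ y)⁻¹ * φ z)
    (by simp) (fun y hy z hz hne ih => ?_) hy hz
  rw [← hmul (g • y) (g • firstVertex V y z), ih, ← hV.smul_firstVertex hX hy hz hne,
    hadj _ (hV.smul_mem g hy) _ (hV.smul_mem g hz) (by simpa using hne),
    hV.smul_firstVertex hX hy hz hne, hM, ← hadj y hy z hz hne, hmul]

omit hX in
-- There are countably many orbits of pairs of vertices, so they can be numbered injectively.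
theorem exists_isLabel : ∃ lab : X → X → ℝ, IsLabel F V lab := by
  let π : X × X → MulAction.orbitRel.Quotient F (X × X) := Quotient.mk _
  obtain ⟨f, hf⟩ := Set.countable_iff_exists_injOn.1 ((hV.countable.prod hV.countable).image π)
  refine ⟨fun y z => f (π (y, z)), fun g y z => ?_, fun {y z y' z'} hy hz hy' hz' h => ?_⟩
  · have : π (g • y, g • z) = π (y, z) :=
      Quotient.sound (MulAction.orbitRel_apply.2 (MulAction.mem_orbit (y, z) g))
    simp only [this]
  · have h1 := hf ⟨(y, z), ⟨hy, hz⟩, rfl⟩ ⟨(y', z'), ⟨hy', hz'⟩, rfl⟩ (Nat.cast_injective h)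
    obtain ⟨g, hg⟩ := show MulAction.orbitRel F (X × X) _ _ from Quotient.exact h1.symm
    exact ⟨g, (Prod.ext_iff.1 hg).1, (Prod.ext_iff.1 hg).2⟩

end IsVertexSet

/-! ### Hyperbolic matrices and their rank one limits -/

open Filter Topology

/-- The rank one matrix with image spanned by `(a, 1)` and kernel spanned by `(r, 1)`. -/
def rankOne (a r : ℝ) : Matrix (Fin 2) (Fin 2) ℝ := !![a, -(a * r); 1, -r]

/-- The product vanishes exactly when the image of the second factor is the kernel of the first. -/
theorem rankOne_mul_rankOne (a r a' r' : ℝ) :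
    rankOne a r * rankOne a' r' = (a' - r) • rankOne a r' := by
  ext i j
  fin_cases i <;> fin_cases j <;> simp [rankOne, Matrix.mul_apply, Fin.sum_univ_two] <;> ring

theorem trace_rankOne (a r : ℝ) : (rankOne a r).trace = a - r := by
  simp [rankOne, Matrix.trace_fin_two, sub_eq_add_neg]

open Classical in
/-- The matrix with eigenvalues `exp t` and `exp (-t)` on `(a, 1)` and `(r, 1)`. -/
noncomputable def hyperbolicMatrix (a r t : ℝ) : Matrix.SpecialLinearGroup (Fin 2) ℝ :=
  if h : a ≠ r then
    ⟨(a - r)⁻¹ • (Real.exp t • rankOne a r - Real.exp (-t) • rankOne r a), by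
      have h' := sub_ne_zero.2 h
      have he : Real.exp t * Real.exp (-t) = 1 := by rw [← Real.exp_add]; simp
      rw [Matrix.det_fin_two]
      simp only [rankOne, Matrix.smul_apply, Matrix.sub_apply, Matrix.of_apply, Matrix.cons_val',
        Matrix.cons_val_zero, Matrix.cons_val_one, Matrix.cons_val_fin_one, smul_eq_mul]
      field_simp
      linear_combination (a - r) ^ 2 * he⟩
  -- With this default, exchanging a and r inverts the matrix for all a and r, as `exists_cocycle`
  -- demands of all pairs of points.
  else 1

theorem coe_hyperbolicMatrix {a r : ℝ} (h : a ≠ r) (t : ℝ) :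
    (hyperbolicMatrix a r t : Matrix (Fin 2) (Fin 2) ℝ) =
      (a - r)⁻¹ • (Real.exp t • rankOne a r - Real.exp (-t) • rankOne r a) :=
  congrArg Subtype.val (dif_pos h)

theorem hyperbolicMatrix_swap (a r t : ℝ) :
    hyperbolicMatrix r a t = (hyperbolicMatrix a r t)⁻¹ := by
  by_cases h : a = r
  · simp [hyperbolicMatrix, h]
  · refine Subtype.ext ?_
    rw [Matrix.SpecialLinearGroup.coe_inv, coe_hyperbolicMatrix h, coe_hyperbolicMatrix (Ne.symm h),
      Matrix.adjugate_fin_two]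
    have h1 := sub_ne_zero.2 h
    have h2 := sub_ne_zero.2 (Ne.symm h)
    ext i j
    fin_cases i <;> fin_cases j <;> simp [rankOne] <;> grind

theorem tendsto_hyperbolicMatrix {a r d : ℝ} (h : a ≠ r) (hd : 0 < d) :
    Tendsto (fun τ : ℝ => Real.exp (-(τ * d)) •
      (hyperbolicMatrix a r (τ * d) : Matrix (Fin 2) (Fin 2) ℝ)) atTop
      (𝓝 ((a - r)⁻¹ • rankOne a r)) := by
  have h1 : Tendsto (fun τ : ℝ => Real.exp (-(τ * d))) atTop (𝓝 0) :=
    Real.tendsto_exp_neg_atTop_nhds_zero.comp (tendsto_id.atTop_mul_const hd)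
  have h2 : Tendsto (fun τ : ℝ => (a - r)⁻¹ • (rankOne a r -
      (Real.exp (-(τ * d)) * Real.exp (-(τ * d))) • rankOne r a)) atTop
      (𝓝 ((a - r)⁻¹ • rankOne a r)) := by
    simpa using (tendsto_const_nhds.sub ((h1.mul h1).smul_const (rankOne r a))).const_smul
      (a - r)⁻¹
  refine h2.congr fun τ => ?_
  have he : Real.exp (-(τ * d)) * Real.exp (τ * d) = 1 := by rw [← Real.exp_add]; simp
  rw [coe_hyperbolicMatrix h, smul_comm, smul_sub (Real.exp _), smul_smul (Real.exp _), he,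
    one_smul, smul_smul (Real.exp _)]

section

variable {F : Type u} [Group F] {X : Type v} [MetricSpace X] [MulAction F X] [IsIsometricSMul F X]

/-- An isometry exchanging y and z fixes the midpoint of [y, z]. -/
theorem IsRTree.eq_of_smul_swap (hX : IsRTree X) (hf : IsFreeAction F X) {g : F} {y z : X}
    (h1 : g • y = z) (h2 : g • z = y) : y = z := by
  obtain ⟨m, hm, hd⟩ := hX.exists_mem_segm y z (t := dist y z / 2) (by positivity)
    (by linarith [dist_nonneg (x := y) (y := z)])
  have hm' := (smul_mem_segm g).2 hm
  rw [h1, h2, segm_comm] at hm'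
  have hg : g • m = m := by
    refine hX.eq_of_mem_segm hm' hm ?_
    rw [← h2, dist_smul, h2]
    have := mem_segm.1 hm
    rw [dist_comm z m]
    linarith
  rw [← h1, hf g m hg, one_smul]

variable {V : Set X}

theorem IsLabel.ne_swap {lab : X → X → ℝ} (hl : IsLabel F V lab) (hX : IsRTree X)
    (hf : IsFreeAction F X) {y z : X} (hy : y ∈ V) (hz : z ∈ V) (hne : y ≠ z) :
    lab y z ≠ lab z y := by
  intro h
  obtain ⟨g, h1, h2⟩ := hl.exists_smul hy hz hz hy h
  exact hne (hX.eq_of_smul_swap hf h1 h2)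

omit [MetricSpace X] [IsIsometricSMul F X] in
theorem IsLabel.right_injective {lab : X → X → ℝ} (hl : IsLabel F V lab) (hf : IsFreeAction F X)
    {y z w : X} (hy : y ∈ V) (hz : z ∈ V) (hw : w ∈ V) (h : lab y z = lab y w) : z = w := by
  obtain ⟨g, h1, h2⟩ := hl.exists_smul hy hz hy hw h
  rw [hf g y h1, one_smul] at h2
  exact h2

/-- The leading term of the holonomy along a segment. -/
theorem IsVertexSet.exists_tendsto (hV : IsVertexSet F V) (hX : IsRTree X)
    (hf : IsFreeAction F X) {lab : X → X → ℝ} (hl : IsLabel F V lab)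
    {H : ℝ → X → X → Matrix.SpecialLinearGroup (Fin 2) ℝ}
    (hmul : ∀ τ y z w, H τ y z * H τ z w = H τ y w)
    (hadj : ∀ τ, ∀ y ∈ V, ∀ z ∈ V, y ≠ z → H τ y (firstVertex V y z) =
      hyperbolicMatrix (lab y (firstVertex V y z)) (lab (firstVertex V y z) y)
        (τ * dist y (firstVertex V y z)))
    {y z : X} (hy : y ∈ V) (hz : z ∈ V) (hne : y ≠ z) :
    ∃ κ : ℝ, κ ≠ 0 ∧ Tendsto (fun τ : ℝ => Real.exp (-(τ * dist y z)) •
      (H τ y z : Matrix (Fin 2) (Fin 2) ℝ)) atTop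
      (𝓝 (κ • rankOne (lab y (firstVertex V y z)) (lab z (firstVertex V z y)))) := by
  refine hV.segm_induction (P := fun y z => y ≠ z → ∃ κ : ℝ, κ ≠ 0 ∧
    Tendsto (fun τ : ℝ => Real.exp (-(τ * dist y z)) •
      (H τ y z : Matrix (Fin 2) (Fin 2) ℝ)) atTop
      (𝓝 (κ • rankOne (lab y (firstVertex V y z)) (lab z (firstVertex V z y)))))
    (fun y _ h => absurd rfl h) (fun y hy z hz hne ih _ => ?_) hy hz hne
  have hfV := hV.firstVertex_mem hy hz hne
  have hfy := hV.firstVertex_ne hy hz hne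
  have hfs := hV.firstVertex_mem_segm hy hz hne
  have hff := hV.firstVertex_symm hy hz hne
  have hne' := hl.ne_swap hX hf hy hfV hfy.symm
  have hlim := tendsto_hyperbolicMatrix hne' (dist_pos.2 hfy.symm)
  simp only [← hadj _ y hy z hz hne] at hlim
  have hfz : firstVertex V y z = z ∨ firstVertex V z (firstVertex V y z) = firstVertex V z y := by
    rw [or_iff_not_imp_left]
    intro h
    rw [segm_comm] at hfs
    exact hV.firstVertex_eq_of_mem_segm hX hz hy hfV hfs h
  have hκ := inv_ne_zero (sub_ne_zero.2 hne')
  generalize firstVertex V y z = f at *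
  by_cases h : f = z
  · subst h
    rw [hff]
    exact ⟨_, hκ, hlim⟩
  · obtain ⟨κ, hκ0, hκlim⟩ := ih h
    rw [hfz.resolve_left h] at hκlim
    -- The geodesic does not backtrack at f, so the directions to y and to z have different labels
    -- and the product of limits is nonzero.
    have hstep : lab f (firstVertex V f z) ≠ lab f y := by
      intro hlab
      have := hl.right_injective hf hfV (hV.firstVertex_mem hfV hz h) hy hlab
      have h2 := mem_segm.1 (hV.firstVertex_mem_segm hfV hz h)
      rw [this] at h2
      have h3 := mem_segm.1 hfs
      linarith [dist_comm y f, dist_pos.2 hfy]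
    refine ⟨(lab y f - lab f y)⁻¹ * κ * (lab f (firstVertex V f z) - lab f y),
      mul_ne_zero (mul_ne_zero hκ hκ0) (sub_ne_zero.2 hstep), ?_⟩
    have hprod := hlim.mul hκlim
    rw [smul_mul_smul_comm, rankOne_mul_rankOne, smul_smul] at hprod
    refine hprod.congr fun τ => ?_
    rw [smul_mul_smul_comm, ← Matrix.SpecialLinearGroup.coe_mul, hmul, ← Real.exp_add,
      ← mem_segm.1 hfs]
    congr 2
    ring

end

/-! ### Axes, translation lengths and growth of traces -/

namespace IsRTree

variable {F : Type u} [Group F] {X : Type v} [MetricSpace X] [MulAction F X] [IsIsometricSMul F X]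
variable (hX : IsRTree X)
include hX

/-- The median of `x`, `g x` and `g⁻¹ x` lies on the axis of `g`. -/
theorem exists_mem_orbitMedians_axis (hf : IsFreeAction F X) (x : X) {g : F} (hg : g ≠ 1) :
    ∃ p ∈ orbitMedians F x, dist p (g • g • p) = 2 * dist p (g • p) := by
  obtain ⟨p, h1, h2, h3, -⟩ := hX.exists_median x (g • x) (g⁻¹ • x)
  refine ⟨p, ⟨1, g, g⁻¹, by simpa using h1, by simpa using h2, h3⟩, ?_⟩
  have hL : dist x (g⁻¹ • x) = dist x (g • x) := by
    rw [← dist_smul g, smul_inv_smul, dist_comm]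
  -- Otherwise the midpoint of [x, gx] lies on [x, g⁻¹x] too, and g⁻¹ fixes it.
  have hlt : 2 * dist x p < dist x (g • x) := by
    by_contra! hle
    obtain ⟨m, hm, hd⟩ := hX.exists_mem_segm x (g • x) (t := dist x (g • x) / 2) (by positivity)
      (by linarith [dist_nonneg (x := x) (y := g • x)])
    have hm2 := segm_subset_left h2 (hX.mem_segm_of_dist_le hm h1 (by linarith))
    have hm3 := (smul_mem_segm g⁻¹).2 hm
    rw [inv_smul_smul, segm_comm] at hm3
    have hfix : g⁻¹ • m = m := by
      refine hX.eq_of_mem_segm hm3 hm2 ?_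
      have e1 := mem_segm.1 hm
      have e2 : dist x (g⁻¹ • m) = dist m (g • x) := by
        rw [← dist_smul g, smul_inv_smul, dist_comm]
      linarith
    exact hg (inv_eq_one.1 (hf _ _ hfix))
  have k1 : g • p ∈ segm x (g • x) := by
    have := (smul_mem_segm g).2 h2
    rwa [smul_inv_smul, segm_comm] at this
  have k2 := mem_segm.1 k1
  rw [dist_comm (g • p), dist_smul] at k2
  have k3 := mem_segm.1 (hX.mem_segm_of_dist_le h1 k1 (by linarith))
  have k4 := mem_segm.1 ((smul_mem_segm g).2 h3)
  rw [smul_inv_smul, dist_comm (g • g • x) (g • p), dist_comm _ x, dist_comm _ x] at k4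
  have k6 : dist (g • g • p) (g • g • x) = dist x p := by rw [dist_smul, dist_smul, dist_comm]
  have k7 : dist (g • p) (g • g • p) = dist p (g • p) := dist_smul _ _ _
  have k8 : dist (g • p) (g • g • x) = dist p (g • x) := dist_smul _ _ _
  have t1 := dist_triangle x p (g • g • x)
  have t2 := dist_triangle p (g • g • p) (g • g • x)
  have t3 := dist_triangle p (g • p) (g • g • p)
  have k5 := mem_segm.1 h1
  linarith

/-- The orbit of p under powers of g runs along a geodesic, so d(p, gⁿp) = n d(p, gp). For any y,
d(y, gⁿy) ≤ n d(y, gy) differs from this by at least -2d(p, y); let n grow. -/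
theorem translationLength_eq {g : F} {p : X} (h : dist p (g • g • p) = 2 * dist p (g • p)) :
    translationLength X g = dist p (g • p) := by
  have : Nonempty X := ⟨p⟩
  refine le_antisymm (ciInf_le ⟨0, by rintro _ ⟨y, rfl⟩; exact dist_nonneg⟩ p)
    (le_ciInf fun y => ?_)
  by_cases hp : p = g • p
  · rw [← hp, dist_self]; exact dist_nonneg
  have hseg : ∀ n : ℕ, g ^ n • p ∈ segm p (g ^ (n + 1) • p) := by
    intro n
    induction n with
    | zero => simpa using left_mem_segm _ _
    | succ n ih =>
      refine hX.mem_segm_trans ih ?_ ?_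
      · have h1 : g • p ∈ segm p (g • g • p) := by
          rw [mem_segm, dist_smul, h]; ring
        simpa [pow_succ, mul_smul] using (smul_mem_segm (g ^ n)).2 h1
      · simpa [pow_succ, mul_smul] using hp
  have hdist : ∀ n : ℕ, dist p (g ^ n • p) = n * dist p (g • p) := by
    intro n
    induction n with
    | zero => simp
    | succ n ih =>
      have h1 := mem_segm.1 (hseg n)
      have h2 : dist (g ^ n • p) (g ^ (n + 1) • p) = dist p (g • p) := by
        rw [pow_succ, mul_smul, dist_smul]
      push_cast
      linarith
  have hdist' : ∀ n : ℕ, dist y (g ^ n • y) ≤ n * dist y (g • y) := by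
    intro n
    induction n with
    | zero => simp
    | succ n ih =>
      have h1 := dist_triangle y (g ^ n • y) (g ^ (n + 1) • y)
      have h2 : dist (g ^ n • y) (g ^ (n + 1) • y) = dist y (g • y) := by
        rw [pow_succ, mul_smul, dist_smul]
      push_cast
      linarith
  by_contra! hlt
  obtain ⟨n, hn⟩ := exists_nat_gt (2 * dist p y / (dist p (g • p) - dist y (g • y)))
  rw [div_lt_iff₀ (by linarith)] at hn
  have h1 := dist_triangle4 p y (g ^ n • y) (g ^ n • p)
  rw [dist_smul, dist_comm y p, hdist n] at h1
  linarith [hdist' n]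

omit [IsIsometricSMul F X] in
theorem translationLength_one : translationLength X (1 : F) = 0 := by
  have := hX.nonempty
  simp [translationLength]

/-- A free discrete action is a limit of representations in `SL(2, ℝ)`: the traces grow
exponentially with rate the translation length. -/
theorem exists_tendsto_trace [Group.FG F] (hf : IsFreeAction F X) (hd : IsDiscreteAction F X) :
    ∃ α : ℝ → F →* Matrix.SpecialLinearGroup (Fin 2) ℝ, ∀ g : F, ∃ c : ℝ, c ≠ 0 ∧
      Tendsto (fun τ : ℝ => Real.exp (-(τ * translationLength X g)) *
        (α τ g : Matrix (Fin 2) (Fin 2) ℝ).trace) atTop (𝓝 c) := by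
  obtain ⟨x⟩ := hX.nonempty
  have hV := hX.isVertexSet_orbitMedians hf hd x
  have hx : ∀ g : F, g • x ∈ orbitMedians F x := fun g => smul_mem_orbitMedians_self g x
  have hx1 : x ∈ orbitMedians F x := by simpa using hx 1
  obtain ⟨lab, hl⟩ := hV.exists_isLabel
  choose H hmul hadj hH using fun τ : ℝ => hV.exists_cocycle hX
    (fun y z => hyperbolicMatrix (lab y z) (lab z y) (τ * dist y z))
    (fun y z => by rw [hyperbolicMatrix_swap, dist_comm])
    (fun g y z => by rw [hl.smul, hl.smul, dist_smul])
  refine ⟨fun τ => MonoidHom.mk' (fun g => H τ x (g • x)) fun g h => ?_, fun g => ?_⟩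
  · rw [← hmul τ x (g • x), mul_smul, hH τ g x hx1 _ (hx h)]
  by_cases hg : g = 1
  · subst hg
    refine ⟨2, two_ne_zero, ?_⟩
    have h1 : ∀ τ, H τ x x = 1 := fun τ => mul_eq_left.1 (hmul τ x x x)
    simp [hX.translationLength_one, h1]
  obtain ⟨p, hp, hax⟩ := hX.exists_mem_orbitMedians_axis hf x hg
  have hne : p ≠ g • p := fun h => hg (hf g p h.symm)
  have hgp := hV.smul_mem g hp
  obtain ⟨κ, hκ, hlim⟩ := hV.exists_tendsto hX hf hl hmul hadj hp hgp hne
  rw [hX.translationLength_eq hax]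
  have htr : Continuous (Matrix.trace : Matrix (Fin 2) (Fin 2) ℝ → ℝ) :=
    continuous_id.matrix_trace
  have hlim' := (htr.tendsto _).comp hlim
  rw [Matrix.trace_smul, trace_rankOne] at hlim'
  refine ⟨_, ?_, hlim'.congr fun τ => ?_⟩
  · refine mul_ne_zero hκ (sub_ne_zero.2 fun h => ?_)
    have hne' : g • p ≠ g • g • p := by simpa using hne
    have hggp := hV.smul_mem g hgp
    rw [← hl.smul g, ← hV.smul_firstVertex hX hp hgp hne] at h
    have h1 := hl.right_injective hf hgp (hV.firstVertex_mem hgp hggp hne')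
      (hV.firstVertex_mem hgp hp hne.symm) h
    have h2 := mem_segm.1 (hV.firstVertex_mem_segm hgp hggp hne')
    have h3 := mem_segm.1 (hV.firstVertex_mem_segm hgp hp hne.symm)
    have h4 := dist_pos.2 (hV.firstVertex_ne hgp hp hne.symm)
    rw [h1, dist_smul] at h2
    rw [dist_comm (g • p) p] at h3
    rw [dist_comm] at h4
    have h5 := dist_triangle p (firstVertex (orbitMedians F x) (g • p) p) (g • g • p)
    rw [dist_comm p (firstVertex _ _ _)] at h5
    linarith
  · have h1 : H τ x (g • x) = H τ x p * H τ p (g • p) * (H τ x p)⁻¹ := by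
      rw [hmul, eq_mul_inv_iff_mul_eq, ← hH τ g x hx1 p hp, hmul]
    simp only [Function.comp_apply, MonoidHom.mk'_apply, Matrix.trace_smul, smul_eq_mul, h1]
    rw [Matrix.SpecialLinearGroup.coe_mul, Matrix.trace_mul_comm,
      ← Matrix.SpecialLinearGroup.coe_mul, inv_mul_cancel_left]

end IsRTree

theorem TraceEquivalent.translationEquivalent {F : Type u} [Group F] [Group.FG F] {a b : F}
    (hab : TraceEquivalent a b) : TranslationEquivalent.{u, v} a b := by
  intro X _ _ _ hX hf hd
  obtain ⟨α, hα⟩ := hX.exists_tendsto_trace hf hd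
  have htr : ∀ τ, (α τ a : Matrix (Fin 2) (Fin 2) ℝ).trace =
      (α τ b : Matrix (Fin 2) (Fin 2) ℝ).trace := by
    intro τ
    have h := hab ((Matrix.SpecialLinearGroup.map (algebraMap ℝ ℂ)).comp (α τ))
    simp only [Matrix.trace_fin_two, MonoidHom.comp_apply,
      Matrix.SpecialLinearGroup.map_apply_coe, RingHom.mapMatrix_apply, Matrix.map_apply,
      Complex.coe_algebraMap] at h
    rw [Matrix.trace_fin_two, Matrix.trace_fin_two]
    exact_mod_cast h
  have key : ∀ g h : F, (∀ τ, (α τ g : Matrix (Fin 2) (Fin 2) ℝ).trace =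
      (α τ h : Matrix (Fin 2) (Fin 2) ℝ).trace) →
      translationLength X g ≤ translationLength X h := by
    intro g h hgh
    obtain ⟨c, hc, hlim⟩ := hα g
    obtain ⟨c', -, hlim'⟩ := hα h
    by_contra! hlt
    have h1 : Tendsto (fun τ : ℝ => Real.exp (-(τ * (translationLength X g -
        translationLength X h)))) atTop (𝓝 0) :=
      Real.tendsto_exp_neg_atTop_nhds_zero.comp (tendsto_id.atTop_mul_const (sub_pos.2 hlt))
    have h2 := h1.mul hlim'
    rw [zero_mul] at h2
    -- If ℓ(g) > ℓ(h), rescaling the common trace at the rate of g would give the limit 0,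
    -- contradicting c ≠ 0.
    refine hc (tendsto_nhds_unique hlim (h2.congr fun τ => ?_))
    rw [hgh, ← mul_assoc, ← Real.exp_add]
    congr 2
    ring
  exact le_antisymm (key a b htr) (key b a fun τ => (htr τ).symm)

theorem mainTheorem10 {F : Type u} [Group F] [IsFreeGroup F] [Group.FG F] (a b : F)
    (hab : TraceEquivalent a b) (w : FreeGroup (Fin 2)) :
    (∀ α : F →* Matrix.SpecialLinearGroup (Fin 2) ℂ,
      Matrix.trace (α (evalWord w a b) : Matrix (Fin 2) (Fin 2) ℂ) =
        Matrix.trace (α (evalWord w b a) : Matrix (Fin 2) (Fin 2) ℂ)) ∧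
    TranslationEquivalent.{u, v} (evalWord w a b) (evalWord w b a) :=
  ⟨hab.evalWord w, (hab.evalWord w).translationEquivalent⟩
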